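/- Let $r\ge 1$ be an integer and let $\sigma,\tau\in\mathbb{C}$ with $\operatorname{Im}\sigma,\operatorname{Im}\tau>0$. Write $(z;q)_\infty=\prod_{j\ge 0}(1-zq^j)$ and $\theta(z\,|\,q)=(z;q)_\infty(qz^{-1};q)_\infty$. For $z\in\mathbb{C}$ and $\mathbf{z}\in\mathbb{Z}$ define the lens theta function $$\theta_\sigma(z,\mathbf{z})=e^{\phi_\sigma(z,\mathbf{z})}\,\theta\big(e^{2\pi i z}e^{2\pi i\sigma\mathbf{z}}\,\big|\,e^{2\pi i\sigma r}\big),$$ $$\phi_\sigma(z,\mathbf{z})=\frac{-\pi i}{6r}\Big(3(r-1-2\mathbf{z})(2z-1)-(r^2-1)(\sigma-\tau-1)+6\mathbf{z}(r-\mathbf{z})(\sigma-1)\Big),$$ and the lens elliptic gamma function $\Gamma(z,\mathbf{z})=e^{\phi_e(z,\mathbf{z})}\gamma_\sigma(z,\mathbf{z})\gamma_\tau(z,\mathbf{z})$, where $$\phi_e(z,\mathbf{z})=\pi i\,\frac{\mathbf{z}(\mathbf{z}-r)\big(6z-3\sigma-3\tau+(1-\sigma+\tau)(r-2\mathbf{z})\big)}{6r},$$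 $$\gamma_\sigma(z,\mathbf{z})=\prod_{j,k=0}^\infty\frac{1-e^{-2\pi i z}e^{-2\pi i\sigma\mathbf{z}}e^{2\pi i(\sigma+\tau)(j+1)}e^{2\pi i\sigma r(k+1)}}{1-e^{2\pi i z}e^{2\pi i\sigma\mathbf{z}}e^{2\pi i(\sigma+\tau)j}e^{2\pi i\sigma rk}},$$ $$\gamma_\tau(z,\mathbf{z})=\prod_{j,k=0}^\infty\frac{1-e^{-2\pi i z}e^{-2\pi i\tau(r-\mathbf{z})}e^{2\pi i(\sigma+\tau)(j+1)}e^{2\pi i\tau r(k+1)}}{1-e^{2\pi i z}e^{2\pi i\tau(r-\mathbf{z})}e^{2\pi i(\sigma+\tau)j}e^{2\pi i\tau rk}}.$$ A sign $\pm$ in the arguments of a function denotes the product of the two factors with $+$ and with $-$, e.g. $\theta_\sigma(x\pm y,\mathbf{x}\pm\mathbf{y})=\theta_\sigma(x+y,\mathbf{x}+\mathbf{y})\,\theta_\sigma(x-y,\mathbf{x}-\mathbf{y})$. For $x=(x_0,\dots,x_7)\in\mathbb{C}^8$ with $\operatorname{Im}x_a>0$ for all $a$, and $\mathbf{x}=(\mathbf{x}_0,\dots,\mathbf{x}_7)\in\mathbb{Z}^8\cup(\mathbb{Z}+\tfrac12)^8$,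 define the elliptic hypergeometric sum/integral $$I(x,\mathbf{x})=\frac{\lambda}{2}\sum_{\mathbf{z}=0}^{r-1}\int_0^1\frac{\prod_{a=0}^{7}\Gamma(x_a\pm z,\mathbf{x}_a\pm\tilde{\mathbf{z}})}{\Gamma(\pm 2z,\pm 2\tilde{\mathbf{z}})}\,dz,\qquad \lambda=(e^{2\pi i r\sigma};e^{2\pi i r\sigma})_\infty\,(e^{2\pi i r\tau};e^{2\pi i r\tau})_\infty,$$ where $\tilde{\mathbf{z}}=\mathbf{z}$ if $\mathbf{x}\in\mathbb{Z}^8$, while for $\mathbf{x}\in(\mathbb{Z}+\tfrac12)^8$ one puts $\tilde{\mathbf{z}}=\mathbf{z}+\frac{r+1}{2}$ if $r$ is even and $\tilde{\mathbf{z}}=\mathbf{z}+\frac r2$ if $r$ is odd. For $k\in\{0,\dots,7\}$ let $T_{\tau,k}$ be the shift operator that replaces $(x_k,\mathbf{x}_k)$ by $(x_k+\tau,\mathbf{x}_k+1)$ and leaves the other variables unchanged. Then, for all such $x,\mathbf{x}$, the integrals defining $I(x,\mathbf{x})$ exist, and for any $i,j,k\in\{0,\dots,7\}$ $$\Big(e^{\frac{2\pi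 i}{r}(x_k-\mathbf{x}_k)}\theta_\sigma(x_j\pm x_k,\mathbf{x}_j\pm\mathbf{x}_k)\,T_{\tau,i}+e^{\frac{2\pi i}{r}(x_i-\mathbf{x}_i)}\theta_\sigma(x_k\pm x_i,\mathbf{x}_k\pm\mathbf{x}_i)\,T_{\tau,j}+e^{\frac{2\pi i}{r}(x_j-\mathbf{x}_j)}\theta_\sigma(x_i\pm x_j,\mathbf{x}_i\pm\mathbf{x}_j)\,T_{\tau,k}\Big)I(x,\mathbf{x})=0,$$ where in the exponents the factor $i$ in $2\pi i$ is the imaginary unit. -/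

import Mathlib

/-!
Throughout, `r` is the positive integer parameter and `σ τ : ℂ` are the parameters in the upper
half plane. A variable is a pair `(z, m)` of a continuous variable `z : ℂ` and a discrete variable
`m : ℚ`. The discrete variables of the sum/integral lie in `ℤ` or in `ℤ + 1/2`; those at which the
lens theta and lens elliptic gamma functions are evaluated are integers, although the defining
formulas make sense for every `m : ℚ`.
-/

namespace LensElliptic

noncomputable section

/-- `e(w) = exp(2πi w)`. -/
def e (w : ℂ) : ℂ := Complex.exp (2 * Real.pi * Complex.I * w)

/-- The infinite `q`-Pochhammer symbol `(z; q)_∞ = ∏_{j ≥ 0} (1 - z q^j)`. -/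
def qPoch (z q : ℂ) : ℂ := ∏' j : ℕ, (1 - z * q ^ j)

/-- The regular theta function `θ(z | q) = (z; q)_∞ (q z⁻¹; q)_∞`. -/
def theta (z q : ℂ) : ℂ := qPoch z q * qPoch (q * z⁻¹) q

/-- The normalisation exponent `φ_σ(z, m; σ, τ)`. -/
def phiSigma (r : ℕ) (σ τ : ℂ) (z : ℂ) (m : ℚ) : ℂ :=
  -(Real.pi * Complex.I) / (6 * r) *
    (3 * (r - 1 - 2 * m) * (2 * z - 1) - ((r : ℂ) ^ 2 - 1) * (σ - τ - 1)
      + 6 * m * (r - m) * (σ - 1))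

/-- The lens theta function `θ_σ(z, m; σ, τ)`. -/
def thetaSigma (r : ℕ) (σ τ : ℂ) (z : ℂ) (m : ℚ) : ℂ :=
  Complex.exp (phiSigma r σ τ z m) * theta (e z * e (σ * m)) (e (σ * r))

/-- The product `θ_σ(z ± w, m ± n) = θ_σ(z + w, m + n) θ_σ(z - w, m - n)`. -/
def thetaSigmaPM (r : ℕ) (σ τ : ℂ) (z : ℂ) (m : ℚ) (w : ℂ) (n : ℚ) : ℂ :=
  thetaSigma r σ τ (z + w) (m + n) * thetaSigma r σ τ (z - w) (m - n)

/-- The infinite product `γ_σ(z, m; σ, τ)`. -/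
def gammaSigma (r : ℕ) (σ τ : ℂ) (z : ℂ) (m : ℚ) : ℂ :=
  ∏' p : ℕ × ℕ,
    (1 - e (-z) * e (-(σ * m)) * e ((σ + τ) * (p.1 + 1)) * e (σ * r * (p.2 + 1))) /
      (1 - e z * e (σ * m) * e ((σ + τ) * p.1) * e (σ * r * p.2))

/-- The infinite product `γ_τ(z, m; σ, τ)`. -/
def gammaTau (r : ℕ) (σ τ : ℂ) (z : ℂ) (m : ℚ) : ℂ :=
  ∏' p : ℕ × ℕ,
    (1 - e (-z) * e (-(τ * (r - m))) * e ((σ + τ) * (p.1 + 1)) * e (τ * r * (p.2 + 1))) /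
      (1 - e z * e (τ * (r - m)) * e ((σ + τ) * p.1) * e (τ * r * p.2))

/-- The normalisation exponent `φ_e(z, m; σ, τ)`. -/
def phiE (r : ℕ) (σ τ : ℂ) (z : ℂ) (m : ℚ) : ℂ :=
  Real.pi * Complex.I *
    (m * (m - r) * (6 * z - 3 * σ - 3 * τ + (1 - σ + τ) * (r - 2 * m))) / (6 * r)

/-- The lens elliptic gamma function `Γ(z, m; σ, τ)`. -/
def lensGamma (r : ℕ) (σ τ : ℂ) (z : ℂ) (m : ℚ) : ℂ :=
  Complex.exp (phiE r σ τ z m) * gammaSigma r σ τ z m * gammaTau r σ τ z m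

/-- The product `Γ(z ± w, m ± n) = Γ(z + w, m + n) Γ(z - w, m - n)`. -/
def lensGammaPM (r : ℕ) (σ τ : ℂ) (z : ℂ) (m : ℚ) (w : ℂ) (n : ℚ) : ℂ :=
  lensGamma r σ τ (z + w) (m + n) * lensGamma r σ τ (z - w) (m - n)

/-- The prefactor `λ(σ, τ)`. -/
def lam (r : ℕ) (σ τ : ℂ) : ℂ :=
  qPoch (e (r * σ)) (e (r * σ)) * qPoch (e (r * τ)) (e (r * τ))

/-- The shifted summation variable
`m + (r + ((r + 1) mod 2)) (X₁ mod 1)`, which is `m` for integral `X`, and for half-integral `X`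
is `m + (r + 1) / 2` or `m + r / 2` according as `r` is even or odd. -/
def zTilde (r : ℕ) (X : Fin 8 → ℚ) (m : ℕ) : ℚ :=
  m + ((r + (r + 1) % 2 : ℕ) : ℚ) * Int.fract (X 1)

/-- The integrand
`∏_{j=0}^{7} Γ(x_j ± z, X_j ± m̃) / Γ(±2z, ±2m̃)`. -/
def integrand (r : ℕ) (σ τ : ℂ) (x : Fin 8 → ℂ) (X : Fin 8 → ℚ) (m : ℕ) (z : ℂ) : ℂ :=
  (∏ j : Fin 8, lensGammaPM r σ τ (x j) (X j) z (zTilde r X m)) /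
    (lensGamma r σ τ (2 * z) (2 * zTilde r X m) *
      lensGamma r σ τ (-(2 * z)) (-(2 * zTilde r X m)))

/-- The elliptic hypergeometric sum/integral `I(x, X; σ, τ)`. -/
def sumIntegral (r : ℕ) (σ τ : ℂ) (x : Fin 8 → ℂ) (X : Fin 8 → ℚ) : ℂ :=
  lam r σ τ / 2 *
    ∑ m ∈ Finset.range r, ∫ z in (0 : ℝ)..1, integrand r σ τ x X m (z : ℂ)

/-- The shift operator `T_{τ,k}`, sending `(x_k, X_k)` to `(x_k + τ, X_k + 1)`. -/
def shift (τ : ℂ) (k : Fin 8) (f : (Fin 8 → ℂ) → (Fin 8 → ℚ) → ℂ) :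
    (Fin 8 → ℂ) → (Fin 8 → ℚ) → ℂ :=
  fun x X => f (Function.update x k (x k + τ)) (Function.update X k (X k + 1))

/-- `X ∈ ℤ⁸ ∪ (ℤ + 1/2)⁸`. -/
def IsIntOrHalfInt (X : Fin 8 → ℚ) : Prop :=
  (∀ j, ∃ n : ℤ, X j = n) ∨ (∀ j, ∃ n : ℤ, X j = n + 1 / 2)

end

end LensElliptic

/-! The relation already holds under the integral sign. Since `Γ(z + τ, m + 1) = θ_σ(z, m) Γ(z, m)`
(`lensGamma_add`), the operator `T_{τ,i}` multiplies the integrand by `θ_σ(x_i ± z, X_i ± z̃)`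
(`integrand_update`). The combination of shifted integrands is then the integrand times the
three-term addition formula `thetaSigmaPM_weierstrass`, which vanishes.

Up to elementary exponentials that formula is the Weierstrass identity for `K(a, b) = a⁻¹ θ(ab)
θ(a/b)`. As functions of `b`, all these kernels lie in one two-dimensional space of quasi-periodic
entire functions, so a 4 × 4 matrix `K(v_i, v_j)` is singular. Being antisymmetric, its determinant
is the square of the Pfaffian, and the Pfaffian is the three-term sum.

The integrals exist because quasi-periodicity in `m` reduces every gamma factor to `0 ≤ m < r`,
where `Γ` is continuous on the upper half plane and `1/Γ` on the closed lower one. Possible zeros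
and poles lie in a countable set, so every identity is needed only almost everywhere. -/

namespace LensElliptic

noncomputable section

/-! ### Infinite products of linear factors -/

section InfiniteProducts

variable {ι : Type*} {u : ι → ℂ}

lemma multipliable_one_sub_mul (hu : Summable fun i => ‖u i‖) (w : ℂ) :
    Multipliable fun i => 1 - w * u i := by
  have : Summable fun i => ‖-(w * u i)‖ := by
    simpa [norm_mul] using hu.mul_left ‖w‖
  simpa [sub_eq_add_neg] using multipliable_one_add_of_summable this

lemma tprod_one_sub_mul_ne_zero (hu : Summable fun i => ‖u i‖) {w : ℂ}
    (h : ∀ i, w * u i ≠ 1) : ∏' i, (1 - w * u i) ≠ 0 := by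
  have hs : Summable fun i => ‖-(w * u i)‖ := by
    simpa [norm_mul] using hu.mul_left ‖w‖
  have := tprod_one_add_ne_zero_of_summable (f := fun i => -(w * u i))
    (fun i hi => h i (by linear_combination -hi)) hs
  simpa [sub_eq_add_neg] using this

lemma differentiable_tprod_one_sub_mul (hu : Summable fun i => ‖u i‖) :
    Differentiable ℂ fun w : ℂ => ∏' i, (1 - w * u i) := by
  intro w₀
  have key : HasProdLocallyUniformlyOn (fun i w => 1 + -(w * u i))
      (fun w => ∏' i, (1 + -(w * u i))) (Metric.ball (0 : ℂ) (‖w₀‖ + 1)) := by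
    refine Summable.hasProdLocallyUniformlyOn_one_add Metric.isOpen_ball
      (hu.mul_left (‖w₀‖ + 1)) (Filter.Eventually.of_forall fun i w hw => ?_)
      (fun i => by fun_prop)
    rw [norm_neg, norm_mul]
    gcongr
    exact (mem_ball_zero_iff.mp hw).le
  have hd := TendstoLocallyUniformlyOn.differentiableOn
    (hasProdLocallyUniformlyOn_iff_tendstoLocallyUniformlyOn.mp key)
    (Filter.Eventually.of_forall fun s => by fun_prop) Metric.isOpen_ball
  have := hd.differentiableAt (Metric.isOpen_ball.mem_nhds
    (show w₀ ∈ Metric.ball (0 : ℂ) (‖w₀‖ + 1) by simp))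
  simpa [sub_eq_add_neg] using this

/-- Also true when a denominator vanishes, both sides being zero then. -/
lemma tprod_one_sub_mul_div (hu : Summable fun i => ‖u i‖) {v : ι → ℂ}
    (hv : Summable fun i => ‖v i‖) (a b : ℂ) :
    ∏' i, (1 - a * u i) / (1 - b * v i) = (∏' i, (1 - a * u i)) / ∏' i, (1 - b * v i) := by
  by_cases h : ∃ i, 1 - b * v i = 0
  · rw [tprod_of_exists_eq_zero h, div_zero, tprod_of_exists_eq_zero]
    obtain ⟨i, hi⟩ := h
    exact ⟨i, by rw [hi, div_zero]⟩
  · push Not at h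
    exact (multipliable_one_sub_mul hu a).tprod_div₀ (multipliable_one_sub_mul hv b)
      (tprod_one_sub_mul_ne_zero hv fun i hi => h i (by rw [hi, sub_self]))

end InfiniteProducts

/-! ### The q-Pochhammer symbol and the theta function -/

lemma summable_norm_pow {q : ℂ} (hq : ‖q‖ < 1) : Summable fun j : ℕ => ‖q ^ j‖ := by
  simpa using summable_geometric_of_lt_one (norm_nonneg q) hq

lemma summable_norm_pow_mul_pow {p q : ℂ} (hp : ‖p‖ < 1) (hq : ‖q‖ < 1) :
    Summable fun n : ℕ × ℕ => ‖p ^ n.1 * q ^ n.2‖ := by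
  simpa using (summable_norm_pow hp).mul_of_nonneg (summable_norm_pow hq)
    (fun _ => norm_nonneg _) (fun _ => norm_nonneg _)

lemma qPoch_eq_mul {q : ℂ} (hq : ‖q‖ < 1) (z : ℂ) :
    qPoch z q = (1 - z) * qPoch (z * q) q := by
  have h := multipliable_one_sub_mul (summable_norm_pow hq) (z * q)
  unfold qPoch
  rw [tprod_eq_zero_mul']
  · simp [pow_succ', mul_assoc]
  · simpa [pow_succ', mul_assoc] using h

lemma qPoch_ne_zero {q z : ℂ} (hq : ‖q‖ < 1) (h : ∀ j : ℕ, z * q ^ j ≠ 1) : qPoch z q ≠ 0 :=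
  tprod_one_sub_mul_ne_zero (summable_norm_pow hq) h

lemma differentiable_qPoch {q : ℂ} (hq : ‖q‖ < 1) : Differentiable ℂ fun z => qPoch z q :=
  differentiable_tprod_one_sub_mul (summable_norm_pow hq)

/-- One Pochhammer factor loses `1 - w` and the other gains `1 - w⁻¹ = -w⁻¹ (1 - w)`. -/
lemma theta_mul_left {q w : ℂ} (hq : ‖q‖ < 1) (hq0 : q ≠ 0) (hw : w ≠ 0) :
    theta (q * w) q = -w⁻¹ * theta w q := by
  unfold theta
  rw [qPoch_eq_mul hq w, show q * (q * w)⁻¹ = w⁻¹ by field_simp, qPoch_eq_mul hq w⁻¹,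
    mul_comm w⁻¹ q, mul_comm w q]
  field_simp
  ring

lemma theta_inv {q w : ℂ} (hq : ‖q‖ < 1) (hw : w ≠ 0) :
    theta w⁻¹ q = -w⁻¹ * theta w q := by
  unfold theta
  rw [qPoch_eq_mul hq w, qPoch_eq_mul hq w⁻¹, inv_inv, mul_comm w⁻¹ q, mul_comm w q]
  field_simp
  ring

lemma differentiableAt_theta {q w : ℂ} (hq : ‖q‖ < 1) (hw : w ≠ 0) :
    DifferentiableAt ℂ (fun w => theta w q) w := by
  have h := differentiable_qPoch hq
  unfold theta
  exact (h w).mul ((h (q * w⁻¹)).comp w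
    ((differentiableAt_inv hw).const_mul q))

lemma theta_ne_zero {q w : ℂ} (hq : ‖q‖ < 1) (hw : ∀ n : ℤ, w * q ^ n ≠ 1) :
    theta w q ≠ 0 := by
  refine mul_ne_zero (qPoch_ne_zero hq fun j => by simpa using hw j)
    (qPoch_ne_zero hq fun j h => hw (-(j + 1 : ℕ)) ?_)
  rw [zpow_neg, zpow_natCast, ← inv_inv (w * _), mul_inv, inv_inv, inv_eq_one, ← h]
  ring

/-- The quasi-periodicity factor of `theta · q` under `w ↦ q ^ n * w` is a monomial. -/
lemma exists_theta_zpow_mul {q : ℂ} (hq : ‖q‖ < 1) (hq0 : q ≠ 0) (n : ℤ) :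
    ∃ C : ℂ, C ≠ 0 ∧ ∀ w : ℂ, w ≠ 0 → theta (q ^ n * w) q = C * w ^ (-n) * theta w q := by
  induction n with
  | zero => exact ⟨1, one_ne_zero, fun w _ => by simp⟩
  | succ n ih =>
    obtain ⟨C, hC, h⟩ := ih
    refine ⟨-C * (q ^ n)⁻¹, by simp [hC, hq0], fun w hw => ?_⟩
    rw [zpow_add_one₀ hq0, mul_comm _ q, mul_assoc,
      theta_mul_left hq hq0 (mul_ne_zero (zpow_ne_zero _ hq0) hw), h w hw, neg_add,
      zpow_add₀ hw]
    simp
    ring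
  | pred n ih =>
    obtain ⟨C, hC, h⟩ := ih
    refine ⟨-C * q ^ (-(n : ℤ) - 1), by simp [hC, hq0, zpow_ne_zero], fun w hw => ?_⟩
    -- The downward step solves the shift equation at `q^(-n-1) w` for the theta value there.
    have h1 := theta_mul_left hq hq0 (mul_ne_zero (zpow_ne_zero (-(n : ℤ) - 1) hq0) hw)
    rw [← mul_assoc, ← zpow_one_add₀ hq0, add_sub_cancel, h w hw] at h1
    have hne : q ^ (-(n : ℤ) - 1) * w ≠ 0 := mul_ne_zero (zpow_ne_zero _ hq0) hw
    rw [show -(-(n : ℤ) - 1) = -(-(n : ℤ)) + 1 by ring, zpow_add_one₀ hw]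
    generalize q ^ (-(n : ℤ) - 1) = Q at *
    have hQ : Q ≠ 0 := left_ne_zero_of_mul hne
    rw [mul_inv] at h1
    field_simp at h1
    linear_combination h1

/-- The double infinite product `∏_{j,k ≥ 0} (1 - w p^j q^k)`. -/
def qPoch₂ (w p q : ℂ) : ℂ := ∏' n : ℕ × ℕ, (1 - w * (p ^ n.1 * q ^ n.2))

/-! ### The double Pochhammer symbol -/

section DoublePochhammer

variable {p q : ℂ}

lemma qPoch₂_swap (w p q : ℂ) : qPoch₂ w p q = qPoch₂ w q p := by
  unfold qPoch₂
  rw [← (Equiv.prodComm ℕ ℕ).tprod_eq]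
  simp [mul_comm]

lemma differentiable_qPoch₂ (hp : ‖p‖ < 1) (hq : ‖q‖ < 1) :
    Differentiable ℂ fun w => qPoch₂ w p q :=
  differentiable_tprod_one_sub_mul (summable_norm_pow_mul_pow hp hq)

lemma qPoch₂_ne_zero (hp : ‖p‖ < 1) (hq : ‖q‖ < 1) {w : ℂ}
    (h : ∀ j k : ℕ, w * (p ^ j * q ^ k) ≠ 1) :
    qPoch₂ w p q ≠ 0 :=
  tprod_one_sub_mul_ne_zero (summable_norm_pow_mul_pow hp hq) fun n => h n.1 n.2

lemma qPoch₂_eq_tprod (hp : ‖p‖ < 1) (hq : ‖q‖ < 1) (w : ℂ) :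
    qPoch₂ w p q = ∏' j : ℕ, qPoch (w * p ^ j) q := by
  have h := multipliable_one_sub_mul (summable_norm_pow_mul_pow hp hq) w
  unfold qPoch₂
  rw [h.tprod_prod' fun j => ?_]
  · simp [qPoch, mul_assoc]
  · simpa [mul_assoc] using multipliable_one_sub_mul (summable_norm_pow hq) (w * p ^ j)

lemma multipliable_qPoch_mul_pow (hp : ‖p‖ < 1) (hq : ‖q‖ < 1) (w : ℂ) :
    Multipliable fun j : ℕ => qPoch (w * p ^ j) q := by
  have h := multipliable_one_sub_mul (summable_norm_pow_mul_pow hp hq) w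
  have := h.hasProd.prod_fiberwise fun j =>
    ((multipliable_one_sub_mul (summable_norm_pow hq) (w * p ^ j)).hasProd.congr_fun
      fun k => by simp [mul_assoc])
  exact this.multipliable

lemma qPoch₂_eq_mul (hp : ‖p‖ < 1) (hq : ‖q‖ < 1) (w : ℂ) :
    qPoch₂ w p q = qPoch w q * qPoch₂ (w * p) p q := by
  rw [qPoch₂_eq_tprod hp hq, qPoch₂_eq_tprod hp hq, tprod_eq_zero_mul']
  · simp [pow_succ', mul_assoc]
  · simpa [pow_succ', mul_assoc] using multipliable_qPoch_mul_pow hp hq (w * p)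

end DoublePochhammer

/-! ### The exponential `e` -/

lemma e_add (a b : ℂ) : e (a + b) = e a * e b := by
  simp [e, mul_add, Complex.exp_add]

lemma e_zero : e 0 = 1 := by simp [e]

lemma e_ne_zero (a : ℂ) : e a ≠ 0 := Complex.exp_ne_zero _

lemma e_neg (a : ℂ) : e (-a) = (e a)⁻¹ := by simp [e, Complex.exp_neg]

lemma e_sub (a b : ℂ) : e (a - b) = e a * (e b)⁻¹ := by
  rw [sub_eq_add_neg, e_add, e_neg]

lemma e_eq_one_iff (a : ℂ) : e a = 1 ↔ ∃ n : ℤ, a = n := by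
  rw [e, Complex.exp_eq_one_iff]
  have : (2 * Real.pi * Complex.I : ℂ) ≠ 0 := Complex.two_pi_I_ne_zero
  refine exists_congr fun n => ⟨fun h => ?_, fun h => by rw [h]; ring⟩
  exact mul_left_cancel₀ this (h.trans (mul_comm _ _))

lemma e_intCast (n : ℤ) : e n = 1 := (e_eq_one_iff _).2 ⟨n, rfl⟩

lemma e_one : e 1 = 1 := by simpa using e_intCast 1

lemma e_nat_mul (n : ℕ) (a : ℂ) : e (n * a) = e a ^ n := by
  rw [e, e, ← Complex.exp_nat_mul]; ring_nf

lemma e_int_mul (n : ℤ) (a : ℂ) : e (n * a) = e a ^ n := by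
  rw [e, e, ← Complex.exp_int_mul]; ring_nf

lemma norm_e (a : ℂ) : ‖e a‖ = Real.exp (-(2 * Real.pi * a.im)) := by
  simp [e, Complex.norm_exp]

lemma norm_e_lt_one {a : ℂ} (ha : 0 < a.im) : ‖e a‖ < 1 := by
  rw [norm_e, Real.exp_lt_one_iff]
  have := mul_pos Real.two_pi_pos ha
  linarith

@[fun_prop]
lemma differentiable_e : Differentiable ℂ e := by
  unfold e; fun_prop

@[fun_prop]
lemma continuous_e : Continuous e := differentiable_e.continuous

/-! ### Contour shifts and Fourier coefficients of periodic entire functions -/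

lemma integral_add_of_periodic {F : ℂ → ℂ} (hF : Differentiable ℂ F)
    (hper : ∀ z, F (z + 1) = F z) (w : ℂ) :
    ∫ t in (0 : ℝ)..1, F (t + w) = ∫ t in (0 : ℝ)..1, F t := by
  -- Cauchy's theorem moves the segment to height `Im w`, the vertical sides cancelling by
  -- periodicity. The remaining real shift only changes the period integrated over.
  have h1 := Complex.integral_boundary_rect_eq_zero_of_differentiableOn F 0 (1 + w.im * Complex.I)
    hF.differentiableOn
  have h2 : ∀ y : ℝ, F (1 + y * Complex.I) = F (y * Complex.I) := fun y => by
    rw [add_comm, hper]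
  have h3 : ∫ t in (0 : ℝ)..1, F t = ∫ t in (0 : ℝ)..1, F (t + w.im * Complex.I) := by
    simp [h2] at h1
    linear_combination h1
  have hp : Function.Periodic (fun t : ℝ => F (t + w.im * Complex.I)) 1 := fun t => by
    simp only [Complex.ofReal_add, Complex.ofReal_one]
    rw [add_right_comm, hper]
  have h4 := hp.intervalIntegral_add_eq w.re 0
  rw [h3, ← zero_add (1 : ℝ), ← h4]
  have h5 := intervalIntegral.integral_comp_add_right (a := 0) (b := 1)
    (fun t : ℝ => F (t + w.im * Complex.I)) w.re
  rw [zero_add, add_comm 1] at h5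
  rw [← h5, zero_add]
  refine intervalIntegral.integral_congr fun t _ => ?_
  simp only [Complex.ofReal_add]
  conv_lhs => rw [← Complex.re_add_im w]
  ring_nf

/-- Vanishing coefficients are trivially summable, so the Fourier series converges pointwise to the
function. -/
lemma eq_zero_of_fourier_eq_zero {F : ℝ → ℂ} (hF : Continuous F)
    (hper : Function.Periodic F 1)
    (h : ∀ n : ℤ, ∫ t in (0 : ℝ)..1, F t * e (-(n * t)) = 0) (t : ℝ) : F t = 0 := by
  have : Fact ((0 : ℝ) < 1) := ⟨one_pos⟩
  let G : C(AddCircle (1 : ℝ), ℂ) := ⟨hper.lift, hF.quotient_lift _⟩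
  have hG : ∀ t : ℝ, G t = F t := fun t => hper.lift_coe t
  have hc : ∀ n, fourierCoeff G n = 0 := fun n => by
    rw [fourierCoeff_eq_intervalIntegral _ n 0, zero_add, one_div, inv_one, one_smul, ← h n]
    refine intervalIntegral.integral_congr fun t _ => ?_
    simp only [hG, fourier_coe_apply, smul_eq_mul, e]
    rw [mul_comm]
    congr 2
    push_cast
    ring
  have hs : Summable (fourierCoeff G) := by
    rw [show fourierCoeff G = fun _ => 0 from funext hc]; exact summable_zero
  have h2 := hasSum_fourier_series_of_summable hs
  simp only [hc, zero_smul] at h2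
  rw [← hG, h2.unique hasSum_zero]
  rfl

/-- Entire functions with the quasi-periodicity of a product of two theta functions are determined
by two Fourier coefficients. -/
lemma eq_zero_of_quasiperiodic {F : ℂ → ℂ} {ρ : ℂ} (hF : Differentiable ℂ F)
    (hper : ∀ z, F (z + 1) = F z) (hρ : ∀ z, F (z + ρ) = F z * e (-ρ - 2 * z))
    (h0 : ∫ t in (0 : ℝ)..1, F t = 0) (h1 : ∫ t in (0 : ℝ)..1, F t * e (-t) = 0) (w : ℂ) :
    F w = 0 := by
  have hshift : ∀ (n : ℤ) (w : ℂ), ∫ t in (0 : ℝ)..1, F (t + w) * e (-(n * (t + w))) =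
      ∫ t in (0 : ℝ)..1, F t * e (-(n * t)) := fun n w =>
    integral_add_of_periodic (F := fun z => F z * e (-(n * z))) (by fun_prop)
      (fun z => by rw [hper, mul_add, neg_add, e_add, mul_one, e_neg n, e_intCast]; simp) w
  -- Moving the contour by `ρ` ties coefficient `n + 2` to coefficient `n` through a nonzero factor,
  -- so coefficients 0 and 1 determine all others in both directions.
  have hrec : ∀ n : ℤ, ∫ t in (0 : ℝ)..1, F t * e (-((n + 2 : ℤ) * t)) =
      e ((n + 1) * ρ) * ∫ t in (0 : ℝ)..1, F t * e (-(n * t)) := fun n => by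
    rw [← hshift n ρ, ← intervalIntegral.integral_const_mul]
    refine intervalIntegral.integral_congr fun t _ => ?_
    simp only [hρ]
    rw [mul_assoc (F t), ← e_add, mul_left_comm _ (F t), ← e_add]
    push_cast
    ring_nf
  have hzero : ∀ n : ℤ, (∫ t in (0 : ℝ)..1, F t * e (-(n * t)) = 0) ∧
      ∫ t in (0 : ℝ)..1, F t * e (-((n + 1 : ℤ) * t)) = 0 := fun n => by
    induction n with
    | zero => simpa [e_zero] using ⟨h0, h1⟩
    | succ n ih =>
      refine ⟨ih.2, ?_⟩
      rw [show (n + 1 + 1 : ℤ) = n + 2 by ring, hrec, ih.1, mul_zero]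
    | pred n ih =>
      have h := hrec (-n - 1)
      rw [show (-n - 1 + 2 : ℤ) = -n + 1 by ring, ih.2, zero_eq_mul] at h
      refine ⟨h.resolve_left (e_ne_zero _), ?_⟩
      rw [sub_add_cancel]
      exact ih.1
  -- The Fourier criterion concerns the real line, so it is applied to the translate of `F` by `w`.
  have hz := eq_zero_of_fourier_eq_zero (F := fun t : ℝ => F (t + w))
    (hF.continuous.comp (by fun_prop))
    (fun t => by
      simp only [Complex.ofReal_add, Complex.ofReal_one]
      rw [← hper (t + w)]
      ring_nf)
    (fun n => by
      have h := (hshift n w).trans (hzero n).1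
      simp only [mul_add, neg_add, e_add, ← mul_assoc] at h
      rw [intervalIntegral.integral_mul_const, mul_eq_zero] at h
      exact h.resolve_right (e_ne_zero _)) 0
  simpa using hz

/-- The antisymmetric kernel `a⁻¹ θ(ab | q) θ(a/b | q)` in additive notation. -/
def thetaKernel (ρ a b : ℂ) : ℂ :=
  e (-a) * (theta (e (a + b)) (e ρ) * theta (e (a - b)) (e ρ))

/-! ### The Weierstrass addition formula -/

section Kernel

variable {ρ : ℂ}

/-- The prefactor `e (-a)` turns the reflection `θ(w⁻¹) = -w⁻¹ θ(w)` into a pure sign. -/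
lemma thetaKernel_antisymm (hρ : 0 < ρ.im) (a b : ℂ) :
    thetaKernel ρ b a = -thetaKernel ρ a b := by
  unfold thetaKernel
  rw [← neg_sub a b, e_neg (a - b), theta_inv (norm_e_lt_one hρ) (e_ne_zero _), ← e_neg,
    add_comm b a, show e (-b) = e (-a) * e (a - b) by rw [← e_add]; ring_nf, e_neg (a - b)]
  have := e_ne_zero (a - b)
  field_simp

lemma differentiable_thetaKernel (hρ : 0 < ρ.im) (a : ℂ) :
    Differentiable ℂ (thetaKernel ρ a) := by
  intro b
  have h := fun w => differentiableAt_theta (norm_e_lt_one hρ) (e_ne_zero w)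
  unfold thetaKernel
  exact (((h (a + b)).comp b (f := fun b => e (a + b)) (by fun_prop)).mul
    ((h (a - b)).comp b (f := fun b => e (a - b)) (by fun_prop))).const_mul _

lemma thetaKernel_add_one (a b : ℂ) : thetaKernel ρ a (b + 1) = thetaKernel ρ a b := by
  unfold thetaKernel
  rw [← add_assoc, e_add _ 1, ← sub_sub, e_sub _ 1, e_one, mul_one, inv_one, mul_one]

/-- The two theta factors contribute `-e(-(a + b))` and `-e(a - b - ρ)`. Their product is free of
`a`, so linear combinations over different `a` keep the same multiplier. -/
lemma thetaKernel_add (hρ : 0 < ρ.im) (a b : ℂ) :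
    thetaKernel ρ a (b + ρ) = thetaKernel ρ a b * e (-ρ - 2 * b) := by
  unfold thetaKernel
  have hq := norm_e_lt_one hρ
  have h2 := theta_mul_left hq (e_ne_zero ρ) (e_ne_zero (a - b - ρ))
  rw [← e_add, add_sub_cancel] at h2
  have h3 : theta (e (a - (b + ρ))) (e ρ) = -e (a - b - ρ) * theta (e (a - b)) (e ρ) := by
    rw [h2, ← sub_sub]
    have := e_ne_zero (a - b - ρ)
    field_simp
  rw [h3, ← add_assoc, add_comm _ ρ, e_add ρ, theta_mul_left hq (e_ne_zero ρ) (e_ne_zero _),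
    show -ρ - 2 * b = -(a + b) + (a - b - ρ) by ring, e_add (-(a + b)), e_neg (a + b)]
  ring

/-- The kernel has rank two, so its Pfaffians of order four vanish: this is the Weierstrass
addition formula for theta functions. -/
theorem thetaKernel_weierstrass (hρ : 0 < ρ.im) (a b c z : ℂ) :
    thetaKernel ρ b c * thetaKernel ρ a z + thetaKernel ρ c a * thetaKernel ρ b z +
      thetaKernel ρ a b * thetaKernel ρ c z = 0 := by
  let v : Fin 4 → ℂ := ![a, b, c, z]
  let coeff : ℤ → ℂ → ℂ := fun n a => ∫ t in (0 : ℝ)..1, thetaKernel ρ a t * e (-(n * t))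
  let M : Matrix (Fin 4) (Fin 4) ℂ := Matrix.of fun i j => thetaKernel ρ (v i) (v j)
  have hdet : M.det = 0 := by
    rw [← Matrix.exists_vecMul_eq_zero_iff]
    -- Recording Fourier coefficients 0 and 1 of `∑ l_i K(v_i, ·)` maps `ℂ⁴` to `ℂ²`. For a nonzero
    -- `l` in its kernel the combination vanishes identically, so `l` is a left null vector of `M`.
    let L : (Fin 4 → ℂ) →ₗ[ℂ] (Fin 2 → ℂ) :=
      Matrix.vecMulLinear (fun i n => coeff ((n : ℕ) : ℤ) (v i))
    have hker : LinearMap.ker L ≠ ⊥ := LinearMap.ker_ne_bot_of_finrank_lt (by simp)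
    obtain ⟨l, hl, hl0⟩ := (Submodule.ne_bot_iff _).1 hker
    have hL : ∀ n : Fin 2, ∑ i, l i * coeff ((n : ℕ) : ℤ) (v i) = 0 := fun n =>
      congrFun (LinearMap.mem_ker.1 hl) n
    have hint : ∀ n : ℤ, ∫ t in (0 : ℝ)..1, (∑ i, l i * thetaKernel ρ (v i) t) * e (-(n * t)) =
        ∑ i, l i * coeff n (v i) := fun n => by
      simp only [coeff, ← intervalIntegral.integral_const_mul, Finset.sum_mul]
      rw [← intervalIntegral.integral_finsetSum]
      · simp only [mul_assoc]
      · intro i _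
        have := (differentiable_thetaKernel hρ (v i)).continuous
        exact Continuous.intervalIntegrable (by fun_prop) _ _
    refine ⟨l, hl0, funext fun j => ?_⟩
    refine eq_zero_of_quasiperiodic (F := fun w => ∑ i, l i * thetaKernel ρ (v i) w) (ρ := ρ)
      ?_ ?_ ?_ ?_ ?_ (v j)
    · exact Differentiable.fun_sum fun i _ => (differentiable_thetaKernel hρ (v i)).const_mul _
    · simp [thetaKernel_add_one]
    · simp [thetaKernel_add hρ, Finset.sum_mul, mul_assoc]
    · simpa [e_zero] using (hint 0).trans (hL 0)
    · simpa using (hint 1).trans (hL 1)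
  have hself : ∀ a, thetaKernel ρ a a = 0 := fun a => by
    have := thetaKernel_antisymm hρ a a
    linear_combination this / 2
  -- The three-term sum is the Pfaffian of `M`, and its square is the determinant.
  rw [← sq_eq_zero_iff, ← hdet]
  simp [Matrix.det_succ_row_zero, Fin.sum_univ_succ, M, v, Fin.succAbove, hself,
    thetaKernel_antisymm hρ a b, thetaKernel_antisymm hρ a z, thetaKernel_antisymm hρ b c,
    thetaKernel_antisymm hρ b z, thetaKernel_antisymm hρ c z, thetaKernel_antisymm hρ c a]
  ring

end Kernel

/-! ### The addition formula for lens theta functions -/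

lemma thetaSigmaPM_eq_thetaKernel {r : ℕ} (hr : r ≠ 0) (σ τ a b : ℂ) (m n : ℚ) :
    thetaSigmaPM r σ τ a m b n =
      Complex.exp (Real.pi * Complex.I * (3 * (r - 1) + (r ^ 2 - 1) * (σ - τ - 1)) / (3 * r)) *
        e m * e ((a - m) / r) * e ((2 * m * a + (σ - 1) * m ^ 2) / r) *
        e ((2 * n * b + (σ - 1) * n ^ 2) / r) *
        thetaKernel (σ * r) (a + σ * m) (b + σ * n) := by
  have hr' : (r : ℂ) ≠ 0 := Nat.cast_ne_zero.2 hr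
  have hadd : e (a + b) * e (σ * ((m + n : ℚ) : ℂ)) = e (a + σ * m + (b + σ * n)) := by
    rw [← e_add]; push_cast; ring_nf
  have hsub : e (a - b) * e (σ * ((m - n : ℚ) : ℂ)) = e (a + σ * m - (b + σ * n)) := by
    rw [← e_add]; push_cast; ring_nf
  unfold thetaSigmaPM thetaSigma thetaKernel
  rw [hadd, hsub, mul_mul_mul_comm, ← mul_assoc _ (e (-(a + σ * m)))]
  congr 1
  simp only [e, ← Complex.exp_add, phiSigma]
  congr 1
  push_cast
  field_simp
  ring

/-- The addition formula for lens theta functions. -/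
theorem thetaSigmaPM_weierstrass {r : ℕ} (hr : r ≠ 0) {σ τ : ℂ} (hσ : 0 < σ.im)
    (a b c z : ℂ) {l m n : ℚ} (k : ℚ) (hlm : ∃ N : ℤ, l + m = N) (hmn : ∃ N : ℤ, m + n = N)
    (hnl : ∃ N : ℤ, n + l = N) :
    e ((c - n) / r) * thetaSigmaPM r σ τ b m c n * thetaSigmaPM r σ τ a l z k +
      e ((a - l) / r) * thetaSigmaPM r σ τ c n a l * thetaSigmaPM r σ τ b m z k +
      e ((b - m) / r) * thetaSigmaPM r σ τ a l b m * thetaSigmaPM r σ τ c n z k = 0 := by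
  -- After a common factor is removed, the terms differ from the kernel identity by `e l * e m`, `e
  -- m * e n` and `e n * e l`. Each is 1 since the sums are integers, including in the half-integral
  -- case.
  have hcast : ∀ {s t : ℚ}, (∃ N : ℤ, s + t = N) → e s * e t = 1 := by
    rintro s t ⟨N, h⟩
    rw [← e_add, ← Rat.cast_add, h, Rat.cast_intCast, e_intCast]
  have hρ : 0 < (σ * r).im := by
    have : (0 : ℝ) < r := by exact_mod_cast Nat.pos_of_ne_zero hr
    simpa using mul_pos hσ this
  have hW := thetaKernel_weierstrass hρ (a + σ * l) (b + σ * m) (c + σ * n) (z + σ * k)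
  simp only [thetaSigmaPM_eq_thetaKernel hr σ τ]
  have h1 := hcast hlm
  have h2 := hcast hmn
  have h3 := hcast hnl
  generalize Complex.exp (Real.pi * Complex.I *
    (3 * (r - 1) + (r ^ 2 - 1) * (σ - τ - 1)) / (3 * r)) = C
  generalize e ((2 * l * a + (σ - 1) * l ^ 2) / r) = Ga
  generalize e ((2 * m * b + (σ - 1) * m ^ 2) / r) = Gb
  generalize e ((2 * n * c + (σ - 1) * n ^ 2) / r) = Gc
  generalize e ((2 * k * z + (σ - 1) * k ^ 2) / r) = Gz
  generalize thetaKernel (σ * r) (b + σ * m) (c + σ * n) = Kbc at *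
  generalize thetaKernel (σ * r) (c + σ * n) (a + σ * l) = Kca at *
  generalize thetaKernel (σ * r) (a + σ * l) (b + σ * m) = Kab at *
  generalize thetaKernel (σ * r) (a + σ * l) (z + σ * k) = Kaz at *
  generalize thetaKernel (σ * r) (b + σ * m) (z + σ * k) = Kbz at *
  generalize thetaKernel (σ * r) (c + σ * n) (z + σ * k) = Kcz at *
  generalize e ((a - l) / r) = Ea
  generalize e ((b - m) / r) = Eb
  generalize e ((c - n) / r) = Ec
  have hterm : ∀ {s t : ℂ}, s * t = 1 → ∀ K K' : ℂ,
      Ea * Eb * Ec * C ^ 2 * Ga * Gb * Gc * Gz * (K * K') =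
        Ea * Eb * Ec * C ^ 2 * Ga * Gb * Gc * Gz * (s * t) * (K * K') := by
    intro s t h K K'
    rw [h, mul_one]
  have e1 := hterm h1 Kbc Kaz
  have e2 := hterm h2 Kca Kbz
  have e3 := hterm h3 Kab Kcz
  linear_combination Ea * Eb * Ec * C ^ 2 * Ga * Gb * Gc * Gz * hW - e1 - e2 - e3

/-- The elliptic gamma function `∏_{j,k ≥ 0} (1 - w⁻¹ p^{j+1} q^{k+1}) / (1 - w p^j q^k)`. -/
def ellGamma (w p q : ℂ) : ℂ := qPoch₂ (w⁻¹ * (p * q)) p q / qPoch₂ w p q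

lemma ellGamma_swap (w p q : ℂ) : ellGamma w p q = ellGamma w q p := by
  rw [ellGamma, ellGamma, qPoch₂_swap, qPoch₂_swap w, mul_comm p q]

/-- The numerator gains `qPoch (w⁻¹ * q) q` and the denominator loses `qPoch w q`, which `hw` keeps
nonzero. Other zeros of the denominator are harmless: both sides are then 0 by division by zero. -/
lemma ellGamma_mul_left {w p q : ℂ} (hp : ‖p‖ < 1) (hq : ‖q‖ < 1) (hp0 : p ≠ 0)
    (hw : ∀ j : ℕ, w * q ^ j ≠ 1) : ellGamma (w * p) p q = theta w q * ellGamma w p q := by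
  have h := qPoch_ne_zero hq hw
  rw [ellGamma, ellGamma, qPoch₂_eq_mul hp hq w, theta,
    show (w * p)⁻¹ * (p * q) = w⁻¹ * q by field_simp, qPoch₂_eq_mul hp hq (w⁻¹ * q),
    mul_assoc w⁻¹ q p, mul_comm q p, mul_comm w⁻¹ q]
  field_simp

lemma ellGamma_mul_right {w p q : ℂ} (hp : ‖p‖ < 1) (hq : ‖q‖ < 1) (hq0 : q ≠ 0)
    (hw : ∀ j : ℕ, w * p ^ j ≠ 1) : ellGamma (w * q) p q = theta w p * ellGamma w p q := by
  rw [ellGamma_swap, ellGamma_mul_left hq hp hq0 hw, ellGamma_swap]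

lemma tprod_div_eq_ellGamma {p q : ℂ} (hp : ‖p‖ < 1) (hq : ‖q‖ < 1) (w : ℂ) :
    ∏' n : ℕ × ℕ, (1 - w⁻¹ * (p * q) * (p ^ n.1 * q ^ n.2)) / (1 - w * (p ^ n.1 * q ^ n.2)) =
      ellGamma w p q :=
  tprod_one_sub_mul_div (summable_norm_pow_mul_pow hp hq) (summable_norm_pow_mul_pow hp hq) _ _

/-! ### Shift equation and discrete quasi-periodicity of the lens gamma function -/

section Gamma

variable {r : ℕ} {σ τ : ℂ}

lemma norm_e_add_lt_one (hσ : 0 < σ.im) (hτ : 0 < τ.im) : ‖e (σ + τ)‖ < 1 :=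
  norm_e_lt_one (by simpa using add_pos hσ hτ)

lemma norm_e_mul_natCast_lt_one (hr : 1 ≤ r) (hσ : 0 < σ.im) : ‖e (σ * r)‖ < 1 :=
  norm_e_lt_one (by simpa using mul_pos hσ (Nat.cast_pos.2 hr))

lemma gammaSigma_eq_ellGamma (hr : 1 ≤ r) (hσ : 0 < σ.im) (hτ : 0 < τ.im) (z : ℂ) (m : ℚ) :
    gammaSigma r σ τ z m = ellGamma (e (z + σ * m)) (e (σ + τ)) (e (σ * r)) := by
  rw [← tprod_div_eq_ellGamma (norm_e_add_lt_one hσ hτ) (norm_e_mul_natCast_lt_one hr hσ)]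
  refine tprod_congr fun n => ?_
  simp only [← e_neg, ← e_nat_mul, ← e_add]
  ring_nf

lemma gammaTau_eq_ellGamma (hr : 1 ≤ r) (hσ : 0 < σ.im) (hτ : 0 < τ.im) (z : ℂ) (m : ℚ) :
    gammaTau r σ τ z m = ellGamma (e (z + τ * (r - m))) (e (σ + τ)) (e (τ * r)) := by
  rw [← tprod_div_eq_ellGamma (norm_e_add_lt_one hσ hτ) (norm_e_mul_natCast_lt_one hr hτ)]
  refine tprod_congr fun n => ?_
  simp only [← e_neg, ← e_nat_mul, ← e_add]
  ring_nf

/-- The countable set `ℤ + ℤσ + ℤτ`, which contains all zeros and poles of the factors of the lens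
elliptic gamma function at integral discrete variables. -/
def exceptionalSet (σ τ : ℂ) : Set ℂ :=
  Set.range fun n : ℤ × ℤ × ℤ => (n.1 + n.2.1 * σ + n.2.2 * τ : ℂ)

lemma e_ne_one_of_notMem {z : ℂ} (hz : z ∉ exceptionalSet σ τ) {w : ℂ} (a b : ℤ)
    (h : w = z + a * σ + b * τ) : e w ≠ 1 := by
  intro h1
  obtain ⟨n, hn⟩ := (e_eq_one_iff _).1 h1
  refine hz ⟨(n, -a, -b), ?_⟩
  push_cast
  linear_combination -hn + h

/-- The shift equation of the lens elliptic gamma function. -/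
lemma lensGamma_add (hr : 1 ≤ r) (hσ : 0 < σ.im) (hτ : 0 < τ.im) {z : ℂ}
    (hz : z ∉ exceptionalSet σ τ) (m : ℤ) :
    lensGamma r σ τ (z + τ) (m + 1) = thetaSigma r σ τ z m * lensGamma r σ τ z m := by
  have hr' : (r : ℂ) ≠ 0 := Nat.cast_ne_zero.2 (by omega)
  unfold lensGamma
  -- The shift moves the argument of `γ_σ` by `σ + τ` and fixes that of `γ_τ`, so a single theta
  -- function appears.
  rw [gammaSigma_eq_ellGamma hr hσ hτ, gammaSigma_eq_ellGamma hr hσ hτ,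
    gammaTau_eq_ellGamma hr hσ hτ, gammaTau_eq_ellGamma hr hσ hτ,
    show z + τ + σ * ((m + 1 : ℚ) : ℂ) = z + σ * ((m : ℚ) : ℂ) + (σ + τ) by push_cast; ring,
    show z + τ + τ * (r - ((m + 1 : ℚ) : ℂ)) = z + τ * (r - ((m : ℚ) : ℂ)) by push_cast; ring,
    e_add _ (σ + τ), ellGamma_mul_left (norm_e_add_lt_one hσ hτ)
      (norm_e_mul_natCast_lt_one hr hσ) (e_ne_zero _), thetaSigma, ← e_add]
  · have hphi : phiE r σ τ (z + τ) (m + 1) = phiSigma r σ τ z m + phiE r σ τ z m := by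
      unfold phiE phiSigma
      push_cast
      field_simp
      ring
    rw [hphi, Complex.exp_add]
    ring
  · intro j
    rw [← e_nat_mul, ← e_add]
    refine e_ne_one_of_notMem hz (m + j * r) 0 ?_
    push_cast
    ring

/-- The lens elliptic gamma function is quasi-periodic in its discrete variable. -/
lemma exists_lensGamma_add_period (hr : 1 ≤ r) (hσ : 0 < σ.im) (hτ : 0 < τ.im) (m : ℤ) :
    ∃ c : ℂ → ℂ, Continuous c ∧ (∀ z, c z ≠ 0) ∧ ∀ z ∉ exceptionalSet σ τ,
      lensGamma r σ τ z ((m + r : ℤ) : ℚ) = c z * lensGamma r σ τ z m := by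
  have hp := norm_e_add_lt_one hσ hτ
  obtain ⟨C, hC, hth⟩ := exists_theta_zpow_mul hp (e_ne_zero (σ + τ)) m
  refine ⟨fun z => Complex.exp (phiE r σ τ z ((m + r : ℤ) : ℚ) - phiE r σ τ z m) *
    (C * e (-m * (z - τ * m))), ?_, fun z => ?_, fun z hz => ?_⟩
  · unfold phiE
    fun_prop
  · exact mul_ne_zero (Complex.exp_ne_zero _) (mul_ne_zero hC (e_ne_zero _))
  -- Raising `m` by `r` gives `γ_σ` one theta factor and removes one from `γ_τ`. Both have nome `e(σ
  -- + τ)`, and their arguments differ by its `m`-th power, so the quotient is a monomial.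
  have hσr : ellGamma (e (z + σ * m + σ * r)) (e (σ + τ)) (e (σ * r)) =
      theta (e (z + σ * m)) (e (σ + τ)) * ellGamma (e (z + σ * m)) (e (σ + τ)) (e (σ * r)) := by
    rw [e_add _ (σ * r), ellGamma_mul_right hp (norm_e_mul_natCast_lt_one hr hσ) (e_ne_zero _)]
    intro j
    rw [← e_nat_mul, ← e_add]
    exact e_ne_one_of_notMem hz (m + j) j (by push_cast; ring)
  have hτr : ellGamma (e (z - τ * m + τ * r)) (e (σ + τ)) (e (τ * r)) =
      theta (e (z - τ * m)) (e (σ + τ)) * ellGamma (e (z - τ * m)) (e (σ + τ)) (e (τ * r)) := by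
    rw [e_add _ (τ * r), ellGamma_mul_right hp (norm_e_mul_natCast_lt_one hr hτ) (e_ne_zero _)]
    intro j
    rw [← e_nat_mul, ← e_add]
    exact e_ne_one_of_notMem hz j (j - m) (by push_cast; ring)
  have hne : theta (e (z - τ * m)) (e (σ + τ)) ≠ 0 := by
    refine theta_ne_zero hp fun n => ?_
    rw [← e_int_mul, ← e_add]
    exact e_ne_one_of_notMem hz n (n - m) (by push_cast; ring)
  have hquot : theta (e (z + σ * m)) (e (σ + τ)) =
      C * e (-m * (z - τ * m)) * theta (e (z - τ * m)) (e (σ + τ)) := by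
    rw [show z + σ * m = m * (σ + τ) + (z - τ * m) by ring, e_add, e_int_mul,
      hth _ (e_ne_zero _), ← e_int_mul]
    push_cast
    rfl
  unfold lensGamma
  rw [gammaSigma_eq_ellGamma hr hσ hτ, gammaSigma_eq_ellGamma hr hσ hτ,
    gammaTau_eq_ellGamma hr hσ hτ, gammaTau_eq_ellGamma hr hσ hτ,
    show z + σ * (((m + r : ℤ) : ℚ) : ℂ) = z + σ * m + σ * r by push_cast; ring,
    show z + τ * (r - (((m + r : ℤ) : ℚ) : ℂ)) = z - τ * m by push_cast; ring,
    show z + σ * ((m : ℚ) : ℂ) = z + σ * m by push_cast; ring,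
    show z + τ * (r - ((m : ℚ) : ℂ)) = z - τ * m + τ * r by push_cast; ring,
    hσr, hτr, hquot]
  simp only [Complex.exp_sub]
  have := Complex.exp_ne_zero (phiE r σ τ z m)
  field_simp

lemma exists_lensGamma_add_int_mul_period (hr : 1 ≤ r) (hσ : 0 < σ.im) (hτ : 0 < τ.im)
    (m n : ℤ) : ∃ c : ℂ → ℂ, Continuous c ∧ (∀ z, c z ≠ 0) ∧ ∀ z ∉ exceptionalSet σ τ,
      lensGamma r σ τ z ((m + n * r : ℤ) : ℚ) = c z * lensGamma r σ τ z m := by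
  induction n with
  | zero => exact ⟨fun _ => 1, continuous_const, fun _ => one_ne_zero, fun z _ => by simp⟩
  | succ n ih =>
    obtain ⟨c, hc, hc0, h⟩ := ih
    obtain ⟨d, hd, hd0, h'⟩ := exists_lensGamma_add_period hr hσ hτ (m + n * r)
    refine ⟨fun z => d z * c z, hd.mul hc, fun z => mul_ne_zero (hd0 z) (hc0 z), fun z hz => ?_⟩
    rw [mul_assoc, ← h z hz, ← h' z hz, add_one_mul, add_assoc]
  | pred n ih =>
    obtain ⟨c, hc, hc0, h⟩ := ih
    obtain ⟨d, hd, hd0, h'⟩ := exists_lensGamma_add_period hr hσ hτ (m + (-n - 1) * r)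
    refine ⟨fun z => c z / d z, hc.div hd hd0, fun z => div_ne_zero (hc0 z) (hd0 z),
      fun z hz => ?_⟩
    rw [div_mul_eq_mul_div, ← h z hz, eq_div_iff (hd0 z), mul_comm, ← h' z hz,
      show m + (-n - 1) * r + r = m + -n * r by ring]

end Gamma

/-! ### Continuity of the gamma factors -/

lemma mul_pow_mul_pow_ne_one {w p q : ℂ} (hp : ‖p‖ < 1) (hq : ‖q‖ < 1) (hw : ‖w‖ < 1)
    (j k : ℕ) : w * (p ^ j * q ^ k) ≠ 1 := by
  intro h
  have h1 : ‖w‖ * (‖p‖ ^ j * ‖q‖ ^ k) = 1 := by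
    rw [← norm_pow, ← norm_pow, ← norm_mul, ← norm_mul, h, norm_one]
  have h2 : ‖p‖ ^ j * ‖q‖ ^ k ≤ 1 :=
    mul_le_one₀ (pow_le_one₀ (norm_nonneg _) hp.le) (by positivity)
      (pow_le_one₀ (norm_nonneg _) hq.le)
  have h3 := mul_le_of_le_one_right (norm_nonneg w) h2
  linarith

lemma continuousAt_ellGamma {w p q : ℂ} (hp : ‖p‖ < 1) (hq : ‖q‖ < 1) (hw0 : w ≠ 0)
    (hw : ‖w‖ < 1) : ContinuousAt (fun w => ellGamma w p q) w := by
  have hc := (differentiable_qPoch₂ hp hq).continuous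
  have hn : ContinuousAt (fun w : ℂ => w⁻¹ * (p * q)) w :=
    (continuousAt_inv₀ hw0).mul continuousAt_const
  exact (hc.continuousAt.comp hn).div hc.continuousAt
    (qPoch₂_ne_zero hp hq (mul_pow_mul_pow_ne_one hp hq hw))

lemma continuousAt_inv_ellGamma {w p q : ℂ} (hp : ‖p‖ < 1) (hq : ‖q‖ < 1) (hw0 : w ≠ 0)
    (hw : ‖w⁻¹ * (p * q)‖ < 1) : ContinuousAt (fun w => (ellGamma w p q)⁻¹) w := by
  have hc := (differentiable_qPoch₂ hp hq).continuous
  have hn : ContinuousAt (fun w : ℂ => w⁻¹ * (p * q)) w :=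
    (continuousAt_inv₀ hw0).mul continuousAt_const
  simp only [ellGamma, inv_div]
  exact hc.continuousAt.div (ContinuousAt.comp (f := fun w : ℂ => w⁻¹ * (p * q))
    hc.continuousAt hn) (qPoch₂_ne_zero hp hq (mul_pow_mul_pow_ne_one hp hq hw))

section Gamma

variable {r : ℕ} {σ τ : ℂ}

lemma continuous_phiE (m : ℚ) : Continuous fun z => phiE r σ τ z m := by
  unfold phiE
  fun_prop

/-- For `0 ≤ m ≤ r` both `z + σ m` and `z + τ (r - m)` stay in the upper half plane, away from the
poles. -/
lemma continuousAt_lensGamma (hr : 1 ≤ r) (hσ : 0 < σ.im) (hτ : 0 < τ.im) {m : ℤ}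
    (hm : 0 ≤ m) (hmr : m ≤ r) {z : ℂ} (hz : 0 < z.im) :
    ContinuousAt (fun z => lensGamma r σ τ z m) z := by
  have hm' : (0 : ℝ) ≤ m := by exact_mod_cast hm
  have hmr' : (m : ℝ) ≤ r := by exact_mod_cast hmr
  simp only [lensGamma, gammaSigma_eq_ellGamma hr hσ hτ, gammaTau_eq_ellGamma hr hσ hτ,
    Rat.cast_intCast]
  have hp := norm_e_add_lt_one hσ hτ
  refine (ContinuousAt.mul ?_ ?_).mul ?_
  · have := continuous_phiE (r := r) (σ := σ) (τ := τ) (m : ℚ)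
    fun_prop
  · refine ContinuousAt.comp (f := fun z => e (z + σ * m)) (continuousAt_ellGamma hp
      (norm_e_mul_natCast_lt_one hr hσ) (e_ne_zero _) (norm_e_lt_one ?_)) (by fun_prop)
    have := mul_nonneg hσ.le hm'
    simp
    linarith
  · refine ContinuousAt.comp (f := fun z => e (z + τ * (r - m))) (continuousAt_ellGamma hp
      (norm_e_mul_natCast_lt_one hr hτ) (e_ne_zero _) (norm_e_lt_one ?_)) (by fun_prop)
    have := mul_nonneg hτ.le (sub_nonneg.2 hmr')
    simp
    linarith

/-- The numerators become denominators. Their extra `σ + τ` keeps them nonzero even at `Im z = 0`.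
-/
lemma continuousAt_inv_lensGamma (hr : 1 ≤ r) (hσ : 0 < σ.im) (hτ : 0 < τ.im) {m : ℤ}
    (hm : 0 ≤ m) (hmr : m ≤ r) {z : ℂ} (hz : z.im ≤ 0) :
    ContinuousAt (fun z => (lensGamma r σ τ z m)⁻¹) z := by
  have hm' : (0 : ℝ) ≤ m := by exact_mod_cast hm
  have hmr' : (m : ℝ) ≤ r := by exact_mod_cast hmr
  simp only [lensGamma, gammaSigma_eq_ellGamma hr hσ hτ, gammaTau_eq_ellGamma hr hσ hτ,
    Rat.cast_intCast, mul_inv, ← Complex.exp_neg]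
  have hp := norm_e_add_lt_one hσ hτ
  refine (ContinuousAt.mul ?_ ?_).mul ?_
  · have := continuous_phiE (r := r) (σ := σ) (τ := τ) (m : ℚ)
    fun_prop
  · refine ContinuousAt.comp (f := fun z => e (z + σ * m)) (continuousAt_inv_ellGamma hp
      (norm_e_mul_natCast_lt_one hr hσ) (e_ne_zero _) ?_) (by fun_prop)
    rw [← e_neg, ← e_add, ← e_add]
    refine norm_e_lt_one ?_
    have := mul_nonneg hσ.le (sub_nonneg.2 hmr')
    simp
    linarith
  · refine ContinuousAt.comp (f := fun z => e (z + τ * (r - m))) (continuousAt_inv_ellGamma hp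
      (norm_e_mul_natCast_lt_one hr hτ) (e_ne_zero _) ?_) (by fun_prop)
    rw [← e_neg, ← e_add, ← e_add]
    refine norm_e_lt_one ?_
    have := mul_nonneg hτ.le hm'
    simp
    linarith

/-- Reduction to `m % r` is available only off the exceptional set, hence a continuous
representative `g`. -/
lemma exists_continuousOn_eq_lensGamma (hr : 1 ≤ r) (hσ : 0 < σ.im) (hτ : 0 < τ.im) (m : ℤ) :
    ∃ g : ℂ → ℂ, ContinuousOn g {z | 0 < z.im} ∧
      ∀ z ∉ exceptionalSet σ τ, lensGamma r σ τ z m = g z := by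
  have hr' : (0 : ℤ) < r := by exact_mod_cast hr
  obtain ⟨c, hc, -, h⟩ := exists_lensGamma_add_int_mul_period hr hσ hτ (m % r) (m / r)
  refine ⟨fun z => c z * lensGamma r σ τ z ((m % r : ℤ) : ℚ), fun z hz => ?_, fun z hz => ?_⟩
  · exact (hc.continuousAt.mul (continuousAt_lensGamma hr hσ hτ (Int.emod_nonneg _ hr'.ne')
      (Int.emod_lt_of_pos _ hr').le hz)).continuousWithinAt
  · simp only [← h z hz, Int.emod_add_ediv_mul]

lemma exists_continuousOn_eq_inv_lensGamma (hr : 1 ≤ r) (hσ : 0 < σ.im) (hτ : 0 < τ.im)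
    (m : ℤ) : ∃ g : ℂ → ℂ, ContinuousOn g {z | z.im ≤ 0} ∧
      ∀ z ∉ exceptionalSet σ τ, (lensGamma r σ τ z m)⁻¹ = g z := by
  have hr' : (0 : ℤ) < r := by exact_mod_cast hr
  obtain ⟨c, hc, hc0, h⟩ := exists_lensGamma_add_int_mul_period hr hσ hτ (m % r) (m / r)
  refine ⟨fun z => (c z)⁻¹ * (lensGamma r σ τ z ((m % r : ℤ) : ℚ))⁻¹, fun z hz => ?_,
    fun z hz => ?_⟩
  · exact ((hc.continuousAt.inv₀ (hc0 z)).mul (continuousAt_inv_lensGamma hr hσ hτ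
      (Int.emod_nonneg _ hr'.ne') (Int.emod_lt_of_pos _ hr').le hz)).continuousWithinAt
  · simp only [← mul_inv, ← h z hz, Int.emod_add_ediv_mul]

end Gamma

/-! ### Discrete variables -/

section Discrete

lemma zTilde_add_one (r : ℕ) (X : Fin 8 → ℚ) (i : Fin 8) (m : ℕ) :
    zTilde r (Function.update X i (X i + 1)) m = zTilde r X m := by
  unfold zTilde
  by_cases h : i = 1
  · subst h
    rw [Function.update_self, Int.fract_add_one]
  · rw [Function.update_of_ne (Ne.symm h)]

lemma IsIntOrHalfInt.update_add_one {X : Fin 8 → ℚ} (hX : IsIntOrHalfInt X) (i : Fin 8) :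
    IsIntOrHalfInt (Function.update X i (X i + 1)) := by
  refine hX.imp (fun h j => ?_) (fun h j => ?_) <;>
  · obtain ⟨n, hn⟩ := h j
    by_cases hj : j = i
    · subst hj
      exact ⟨n + 1, by rw [Function.update_self, hn]; push_cast; ring⟩
    · exact ⟨n, by rw [Function.update_of_ne hj, hn]⟩

lemma IsIntOrHalfInt.exists_add {X : Fin 8 → ℚ} (hX : IsIntOrHalfInt X) (i j : Fin 8) :
    ∃ N : ℤ, X i + X j = N := by
  rcases hX with h | h <;> obtain ⟨a, ha⟩ := h i <;> obtain ⟨b, hb⟩ := h j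
  · exact ⟨a + b, by rw [ha, hb]; push_cast; ring⟩
  · exact ⟨a + b + 1, by rw [ha, hb]; push_cast; ring⟩

/-- The summation variable has the same class modulo `ℤ` as the discrete parameters. -/
lemma IsIntOrHalfInt.exists_add_sub_zTilde {X : Fin 8 → ℚ} (hX : IsIntOrHalfInt X) (r m : ℕ)
    (j : Fin 8) : (∃ N : ℤ, X j + zTilde r X m = N) ∧ (∃ N : ℤ, X j - zTilde r X m = N) ∧
      ∃ N : ℤ, 2 * zTilde r X m = N := by
  unfold zTilde
  rcases hX with h | h <;> obtain ⟨a, ha⟩ := h 1 <;> obtain ⟨b, hb⟩ := h j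
  · rw [ha, hb, Int.fract_intCast]
    exact ⟨⟨b + m, by push_cast; ring⟩, ⟨b - m, by push_cast; ring⟩, ⟨2 * m, by push_cast; ring⟩⟩
  · have hf : Int.fract (X 1) = 1 / 2 := by
      rw [ha, Int.fract_intCast_add, Int.fract_eq_self]
      norm_num
    -- This is the odd one of `r` and `r + 1`, so its half is a half-integer.
    obtain ⟨t, ht⟩ : ∃ t : ℕ, r + (r + 1) % 2 = 2 * t + 1 := ⟨r / 2, by omega⟩
    rw [hf, hb, ht]
    exact ⟨⟨b + m + t + 1, by push_cast; ring⟩, ⟨b - m - t, by push_cast; ring⟩,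
      ⟨2 * m + 2 * t + 1, by push_cast; ring⟩⟩

end Discrete

/-! ### Integrability and shifts of the integrand -/

section Integral

open MeasureTheory

variable {r : ℕ} {σ τ : ℂ}

lemma countable_exceptionalSet (σ τ : ℂ) : (exceptionalSet σ τ).Countable :=
  Set.countable_range _

lemma ae_notMem_exceptionalSet (σ τ : ℂ) {f : ℝ → ℂ} (hf : Function.Injective f) :
    ∀ᵐ t : ℝ, f t ∉ exceptionalSet σ τ := by
  have h : (f ⁻¹' exceptionalSet σ τ).Countable :=
    (countable_exceptionalSet σ τ).preimage hf
  exact h.ae_notMem volume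

lemma ae_add_sub_notMem (σ τ : ℂ) (x : Fin 8 → ℂ) :
    ∀ᵐ t : ℝ, ∀ j, x j + t ∉ exceptionalSet σ τ ∧ x j - t ∉ exceptionalSet σ τ := by
  rw [ae_all_iff]
  intro j
  refine (ae_notMem_exceptionalSet σ τ fun s t h => ?_).and
    (ae_notMem_exceptionalSet σ τ fun s t h => ?_)
  · simpa using h
  · simpa using h

lemma ae_two_mul_notMem (σ τ : ℂ) :
    ∀ᵐ t : ℝ, 2 * (t : ℂ) ∉ exceptionalSet σ τ ∧ -(2 * (t : ℂ)) ∉ exceptionalSet σ τ := by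
  refine (ae_notMem_exceptionalSet σ τ fun s t h => ?_).and
    (ae_notMem_exceptionalSet σ τ fun s t h => ?_)
  · simpa using h
  · simpa using h

/-- For real `t`, the points `x j ± t` lie in the upper half plane and `±2t` on the real axis, so
the integrand agrees almost everywhere with a continuous function. -/
theorem intervalIntegrable_integrand (hr : 1 ≤ r) (hσ : 0 < σ.im) (hτ : 0 < τ.im)
    {x : Fin 8 → ℂ} (hx : ∀ a, 0 < (x a).im) {X : Fin 8 → ℚ} (hX : IsIntOrHalfInt X) (m : ℕ)
    (a b : ℝ) :
    IntervalIntegrable (fun t : ℝ => integrand r σ τ x X m (t : ℂ)) volume a b := by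
  choose A hA using fun j => (hX.exists_add_sub_zTilde r m j).1
  choose B hB using fun j => (hX.exists_add_sub_zTilde r m j).2.1
  obtain ⟨N, hN⟩ := (hX.exists_add_sub_zTilde r m 0).2.2
  choose f hf hf' using fun j => exists_continuousOn_eq_lensGamma hr hσ hτ (A j)
  choose g hg hg' using fun j => exists_continuousOn_eq_lensGamma hr hσ hτ (B j)
  obtain ⟨u, hu, hu'⟩ := exists_continuousOn_eq_inv_lensGamma hr hσ hτ N
  obtain ⟨v, hv, hv'⟩ := exists_continuousOn_eq_inv_lensGamma hr hσ hτ (-N)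
  have hcont : Continuous fun t : ℝ => (∏ j, f j (x j + t) * g j (x j - t)) *
      (u (2 * t) * v (-(2 * t))) := by
    refine Continuous.mul (continuous_finsetProd _ fun j _ => Continuous.mul ?_ ?_)
      (Continuous.mul ?_ ?_)
    · exact (hf j).comp_continuous (by fun_prop) fun t => by simpa using hx j
    · exact (hg j).comp_continuous (by fun_prop) fun t => by simpa using hx j
    · exact hu.comp_continuous (by fun_prop) fun t => by simp
    · exact hv.comp_continuous (by fun_prop) fun t => by simp
  refine (hcont.intervalIntegrable a b).congr_ae (ae_restrict_of_ae ?_)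
  filter_upwards [ae_add_sub_notMem σ τ x, ae_two_mul_notMem σ τ] with t ht ht2
  have hN' : -(2 * zTilde r X m) = ((-N : ℤ) : ℚ) := by rw [hN]; push_cast; rfl
  rw [integrand, div_eq_mul_inv, mul_inv, hN', hN, ← hu' _ ht2.1, ← hv' _ ht2.2]
  congr 1
  refine Finset.prod_congr rfl fun j _ => ?_
  rw [lensGammaPM, hA, hB, hf' j _ (ht j).1, hg' j _ (ht j).2]

lemma integrand_update (hr : 1 ≤ r) (hσ : 0 < σ.im) (hτ : 0 < τ.im) {x : Fin 8 → ℂ}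
    {X : Fin 8 → ℚ} (hX : IsIntOrHalfInt X) (m : ℕ) (i : Fin 8) {z : ℂ}
    (hz : x i + z ∉ exceptionalSet σ τ) (hz' : x i - z ∉ exceptionalSet σ τ) :
    integrand r σ τ (Function.update x i (x i + τ)) (Function.update X i (X i + 1)) m z =
      thetaSigmaPM r σ τ (x i) (X i) z (zTilde r X m) * integrand r σ τ x X m z := by
  obtain ⟨⟨A, hA⟩, ⟨B, hB⟩, -⟩ := hX.exists_add_sub_zTilde r m i
  have hshift : lensGammaPM r σ τ (x i + τ) (X i + 1) z (zTilde r X m) =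
      thetaSigmaPM r σ τ (x i) (X i) z (zTilde r X m) *
        lensGammaPM r σ τ (x i) (X i) z (zTilde r X m) := by
    unfold lensGammaPM thetaSigmaPM
    rw [add_right_comm (x i), add_right_comm (X i), add_sub_right_comm (x i),
      add_sub_right_comm (X i), hA, hB, lensGamma_add hr hσ hτ hz, lensGamma_add hr hσ hτ hz']
    ring
  unfold integrand
  rw [zTilde_add_one, ← mul_div_assoc]
  congr 1
  rw [← Finset.mul_prod_erase _ _ (Finset.mem_univ i),
    ← Finset.mul_prod_erase _ (fun j => lensGammaPM r σ τ (x j) (X j) z _) (Finset.mem_univ i),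
    Function.update_self, Function.update_self, hshift, mul_assoc]
  congr 2
  refine Finset.prod_congr rfl fun j hj => ?_
  rw [Function.update_of_ne (Finset.ne_of_mem_erase hj),
    Function.update_of_ne (Finset.ne_of_mem_erase hj)]

lemma im_update_add_pos (hτ : 0 < τ.im) {x : Fin 8 → ℂ} (hx : ∀ a, 0 < (x a).im) (i a : Fin 8) :
    0 < (Function.update x i (x i + τ) a).im := by
  by_cases h : a = i
  · subst h
    simpa using add_pos (hx a) hτ
  · simpa [h] using hx a

end Integral

end

end LensElliptic

/-! ### The contiguous relation -/

open LensElliptic in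
theorem proposition3p1 (r : ℕ) (hr : 1 ≤ r) (σ τ : ℂ) (hσ : 0 < σ.im) (hτ : 0 < τ.im)
    (x : Fin 8 → ℂ) (hx : ∀ a, 0 < (x a).im)
    (X : Fin 8 → ℚ) (hX : IsIntOrHalfInt X) (i j k : Fin 8) :
    -- the integrals that define `I(x, X)` exist (and so do those of its shifts, whose
    -- variables satisfy the same hypotheses)
    (∀ m ∈ Finset.range r, IntervalIntegrable
      (fun z : ℝ => integrand r σ τ x X m (z : ℂ)) MeasureTheory.volume 0 1) ∧
    e ((x k - X k) / r) * thetaSigmaPM r σ τ (x j) (X j) (x k) (X k) *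
        shift τ i (sumIntegral r σ τ) x X
      + e ((x i - X i) / r) * thetaSigmaPM r σ τ (x k) (X k) (x i) (X i) *
        shift τ j (sumIntegral r σ τ) x X
      + e ((x j - X j) / r) * thetaSigmaPM r σ τ (x i) (X i) (x j) (X j) *
        shift τ k (sumIntegral r σ τ) x X = 0 := by
  refine ⟨fun m _ => intervalIntegrable_integrand hr hσ hτ hx hX m 0 1, ?_⟩
  have hint : ∀ (l : Fin 8) (m : ℕ), IntervalIntegrable (fun t : ℝ => integrand r σ τ
      (Function.update x l (x l + τ)) (Function.update X l (X l + 1)) m (t : ℂ))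
      MeasureTheory.volume 0 1 := fun l m =>
    intervalIntegrable_integrand hr hσ hτ (im_update_add_pos hτ hx l) (hX.update_add_one l) m 0 1
  have hzero : ∀ m : ℕ, ∀ᵐ t : ℝ,
      e ((x k - X k) / r) * thetaSigmaPM r σ τ (x j) (X j) (x k) (X k) *
        integrand r σ τ (Function.update x i (x i + τ)) (Function.update X i (X i + 1)) m t +
      e ((x i - X i) / r) * thetaSigmaPM r σ τ (x k) (X k) (x i) (X i) *
        integrand r σ τ (Function.update x j (x j + τ)) (Function.update X j (X j + 1)) m t +
      e ((x j - X j) / r) * thetaSigmaPM r σ τ (x i) (X i) (x j) (X j) *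
        integrand r σ τ (Function.update x k (x k + τ)) (Function.update X k (X k + 1)) m t =
      0 := by
    intro m
    filter_upwards [ae_add_sub_notMem σ τ x] with t ht
    rw [integrand_update hr hσ hτ hX m i (ht i).1 (ht i).2,
      integrand_update hr hσ hτ hX m j (ht j).1 (ht j).2,
      integrand_update hr hσ hτ hX m k (ht k).1 (ht k).2]
    -- The fourth point of the addition formula is the integration variable paired with `z̃`, which
    -- no shift changes.
    linear_combination integrand r σ τ x X m t *
      thetaSigmaPM_weierstrass (τ := τ) (Nat.one_le_iff_ne_zero.1 hr) hσ (x i) (x j) (x k) t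
        (zTilde r X m) (hX.exists_add i j) (hX.exists_add j k) (hX.exists_add k i)
  simp only [shift, sumIntegral]
  generalize e ((x k - X k) / r) * thetaSigmaPM r σ τ (x j) (X j) (x k) (X k) = P at *
  generalize e ((x i - X i) / r) * thetaSigmaPM r σ τ (x k) (X k) (x i) (X i) = Q at *
  generalize e ((x j - X j) / r) * thetaSigmaPM r σ τ (x i) (X i) (x j) (X j) = R at *
  have hsum : ∀ m : ℕ,
      P * (∫ t in (0 : ℝ)..1, integrand r σ τ (Function.update x i (x i + τ))
        (Function.update X i (X i + 1)) m (t : ℂ)) +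
      Q * (∫ t in (0 : ℝ)..1, integrand r σ τ (Function.update x j (x j + τ))
        (Function.update X j (X j + 1)) m (t : ℂ)) +
      R * (∫ t in (0 : ℝ)..1, integrand r σ τ (Function.update x k (x k + τ))
        (Function.update X k (X k + 1)) m (t : ℂ)) = 0 := by
    intro m
    have hi := (hint i m).const_mul P
    have hj := (hint j m).const_mul Q
    have hk := (hint k m).const_mul R
    rw [← intervalIntegral.integral_const_mul, ← intervalIntegral.integral_const_mul,
      ← intervalIntegral.integral_const_mul, ← intervalIntegral.integral_add hi hj,
      ← intervalIntegral.integral_add (hi.add hj) hk]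
    refine intervalIntegral.integral_zero_ae ?_
    filter_upwards [hzero m] with t ht _ using ht
  have htotal := Finset.sum_eq_zero fun m (_ : m ∈ Finset.range r) => hsum m
  rw [Finset.sum_add_distrib, Finset.sum_add_distrib, ← Finset.mul_sum, ← Finset.mul_sum,
    ← Finset.mul_sum] at htotal
  linear_combination lam r σ τ / 2 * htotal
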